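/- Let $G$ be a finitely generated group with infinitely many ends. A Stallings--Dunwoody decomposition of $G$ is an action of $G$ on a simplicial tree $T$, by automorphisms and without inversions, with finitely many orbits of vertices and edges, with finite edge stabilisers, and such that every vertex stabiliser is either finite or (finitely generated and) one-ended; equivalently, it is a splitting of $G$ as a finite graph of groups with finite edge groups whose vertex groups have at most one end. Assume that $G$ is accessible, i.e. that it has such a decomposition. Suppose that $T$ is a Stallings--Dunwoody decomposition of $G$ such that for each vertex $v$ of $T$ with one-ended stabiliser $G_v$ there is a finite-index normal subgroup $K_v \trianglelefteq G_v$ with $K_v \cap G_e = 1$ for every edge $e$ of $T$ incident to $v$. Then $G$ has a finite-index subgroup $K$ that is a free product $$K = H_1 * \cdots * H_m * F$$ of finitely many one-ended groups $H_1,\dots,H_m$ and a finitely generated free group $F$ (where $m=0$ and $F=1$ are allowed). Furthermore, for every automorphism $\Phi$ of $G$ there is an integer $k \ge 1$ such that $\Phi^k(K)=K$ and, writing $\Psi = \Phi^k|_K \in \operatorname{Aut}(K)$, the suspension $K_\Psi = K \rtimes_\Psi \mathbb{Z}$ is a finite-index subgroup of the suspension $G_\Phi = G \rtimes_\Phi \mathbb{Z}$: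 the inclusion $K \hookrightarrow G$ together with $s \mapsto t^k$, where $s$ and $t$ are the stable letters of $K_\Psi$ and $G_\Phi$, extends to an injective homomorphism $K_\Psi \to G_\Phi$ with image of finite index. -/

import Mathlib

universe u v

/-- The number of ends of the Cayley graph of `G` with respect to the set `S`. -/
noncomputable def cayleyNumEnds {G : Type u} [Group G] (S : Set G) : ℕ∞ :=
  (SimpleGraph.mulCayley S).end.encard

/-- A finitely generated group with exactly one end (the number of ends of the Cayley graph does
not depend on the chosen finite generating set). -/
def IsOneEnded (G : Type u) [Group G] : Prop :=
  ∃ S : Finset G, Subgroup.closure (S : Set G) = ⊤ ∧ cayleyNumEnds (S : Set G) = 1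

/-- A finitely generated group with infinitely many ends. -/
def IsInfinitelyEnded (G : Type u) [Group G] : Prop :=
  ∃ S : Finset G, Subgroup.closure (S : Set G) = ⊤ ∧ cayleyNumEnds (S : Set G) = ⊤

/-- The simplicial tree `T`, with its action of `G`, is a Stallings–Dunwoody decomposition of `G`:
`G` acts on `T` by automorphisms, without inversions and with finitely many orbits of vertices and
edges (so that the quotient is a finite graph of groups), edge groups are finite, and every vertex
group is finite or one-ended. The vertex group of `v` is its stabiliser, and the edge group of the
edge joining `v` and `w` is the intersection of their stabilisers. -/
structure IsStallingsDunwoody (G : Type u) [Group G] {V : Type v} [MulAction G V]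
    (T : SimpleGraph V) : Prop where
  isTree : T.IsTree
  smul_adj : ∀ (g : G) (v w : V), T.Adj v w → T.Adj (g • v) (g • w)
  no_inversion : ∀ (g : G) (v w : V), T.Adj v w → ¬ (g • v = w ∧ g • w = v)
  finite_vertex_orbits : ∃ F : Set V, F.Finite ∧ ∀ v : V, ∃ g : G, g • v ∈ F
  finite_edge_orbits : ∃ F : Set (V × V), F.Finite ∧
    ∀ v w : V, T.Adj v w → ∃ g : G, (g • v, g • w) ∈ F
  finite_edge_group : ∀ v w : V, T.Adj v w →
    Finite (MulAction.stabilizer G v ⊓ MulAction.stabilizer G w : Subgroup G)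
  vertex_group : ∀ v : V,
    Finite (MulAction.stabilizer G v) ∨ IsOneEnded (MulAction.stabilizer G v)

/-- A group is accessible if it has a Stallings–Dunwoody decomposition. -/
def IsAccessible (G : Type u) [Group G] : Prop :=
  ∃ (V : Type u) (_ : MulAction G V) (T : SimpleGraph V), IsStallingsDunwoody G T

/-- `K` is the (internal) free product `H₁ * ⋯ * Hₘ * F` of finitely many one-ended subgroups `Hᵢ`
and a free group `F` of finite rank `r`; `m` and `r` may be zero. -/
def IsFreeProductOneEndedFree (K : Type u) [Group K] : Prop :=
  ∃ (m r : ℕ) (H : Fin m → Subgroup K) (f : FreeGroup (Fin r) →* K),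
    (∀ i, IsOneEnded (H i)) ∧
    Function.Bijective
      (Monoid.Coprod.lift (Monoid.CoprodI.lift fun i => (H i).subtype) f)

/-- The suspension `G ⋊_Φ ℤ`, in which the generator of `ℤ` acts on `G` as `Φ`. -/
abbrev Suspension {G : Type u} [Group G] (Φ : MulAut G) : Type u :=
  SemidirectProduct G (Multiplicative ℤ) (zpowersHom (MulAut G) Φ)

/-- The stable letter `t` of the suspension, for which `t g t⁻¹ = Φ g`. -/
def Suspension.t {G : Type u} [Group G] (Φ : MulAut G) : Suspension Φ :=
  SemidirectProduct.inr (Multiplicative.ofAdd 1)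

/-! It suffices to find a homomorphism `φ` from `G` to a finite group whose kernel `K` meets all
edge groups and all finite vertex groups trivially. Then `K` acts on `T` with finitely many orbits
and trivial edge groups, and its vertex groups are trivial or of finite index in one-ended groups,
hence one-ended; by Bass–Serre theory `K` is the required free product.

To build `φ`, let `X` be the product of the finite groups `G_r / N_r` over representatives `r` of
the vertex orbits, with `N_r = 1` when `G_r` is finite. Each `G_r` acts on `X` by translating its
own factor, and incident edge groups act freely because they miss `N_r`. Free actions of a finite
group on a finite set are conjugate (`exists_perm_intertwining`), so the actions at the two ends of
an edge can be matched, and all of them glue to a homomorphism `G →* Equiv.Perm X`.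

The gluing is `exists_hom_of_cocycle`, which uses cocycles on the tree instead of presentations.
With a free product as target, the same lemma yields the inverse of the map from the free product to
`K`.

One-endedness passes to finite-index subgroups through almost invariant sets. For suspensions, the
set of homomorphisms from `G` to a finite group is finite, so `φ ∘ Φ ^ k = φ` for some `k ≥ 1`, and
`Φ ^ k` preserves `K`. -/

/-! ### Cocycles on trees and the homomorphisms they define. -/

section TreeCocycles

variable {V : Type*} {T : SimpleGraph V} {P : Type*} [Group P]

/-- On a tree every antisymmetric function on oriented edges is a coboundary. -/
theorem SimpleGraph.IsTree.exists_potential (hT : T.IsTree) (v₀ : V) (c : V → V → P)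
    (hc : ∀ v w, T.Adj v w → c w v = (c v w)⁻¹) :
    ∃ f : V → P, f v₀ = 1 ∧ ∀ v w, T.Adj v w → f w = f v * c v w := by
  classical
  let wt : ∀ {a b : V}, T.Walk a b → P := fun p => (p.darts.map fun d => c d.fst d.snd).prod
  choose p hp hup using fun w => hT.existsUnique_path v₀ w
  -- The potential at `w` is the product of `c` along the path from `v₀`. Of two adjacent vertices,
  -- one lies on the path to the other, so the two paths differ by a single edge.
  have key : ∀ v w (h : T.Adj v w), v ∈ (p w).support → wt (p w) = wt (p v) * c v w := by
    intro v w h hv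
    rw [hT.isAcyclic.path_concat (hp v) (hp w) h hv]
    simp [wt, SimpleGraph.Walk.darts_concat]
  refine ⟨fun w => wt (p w), ?_, fun v w h => ?_⟩
  · change wt (p v₀) = 1
    rw [← hup v₀ SimpleGraph.Walk.nil SimpleGraph.Walk.IsPath.nil]
    simp [wt]
  · by_cases hv : v ∈ (p w).support
    · exact key v w h hv
    · have hw := hT.isAcyclic.mem_support_of_ne_mem_support_of_adj_of_isPath (hp v) (hp w) h hv
      change wt (p w) = wt (p v) * c v w
      rw [key w v h.symm hw, hc v w h]
      group

theorem SimpleGraph.Connected.eq_of_forall_adj {α : Type*} (hT : T.Connected) (f : V → α)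
    (hf : ∀ v w, T.Adj v w → f v = f w) (v w : V) : f v = f w := by
  obtain ⟨p⟩ := hT.preconnected v w
  induction p with
  | nil => rfl
  | cons h _ ih => exact (hf _ _ h).trans ih

variable {G : Type*} [Group G] [MulAction G V]

/-- `D` consists of one orientation of one representative of each orbit of edges of `T`. -/
structure IsEdgeTransversal (G : Type*) [Group G] {V : Type*} [MulAction G V] (T : SimpleGraph V)
    (D : Set (V × V)) : Prop where
  adj : ∀ d ∈ D, T.Adj d.1 d.2
  exists_smul : ∀ v w, T.Adj v w → ∃ g : G, ∃ d ∈ D, g • d = (v, w) ∨ g • d = (w, v)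
  eq_of_smul_eq : ∀ d ∈ D, ∀ d' ∈ D, ∀ g : G, g • d = d' → d = d'
  smul_ne_swap : ∀ d ∈ D, ∀ d' ∈ D, ∀ g : G, g • d ≠ d'.swap

/-- A homomorphism out of a group acting on a tree, built from a cocycle on the vertices and a
compatible choice of values on representatives of the edges. -/
theorem exists_hom_of_cocycle (hT : T.IsTree)
    (hadj : ∀ (g : G) (v w : V), T.Adj v w → T.Adj (g • v) (g • w))
    {D : Set (V × V)} (hD : IsEdgeTransversal G T D) (v₀ : V)
    (σ : G → V → P) (hσ : ∀ g h v, σ (g * h) v = σ g (h • v) * σ h v)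
    (τ : V × V → P)
    (hτ : ∀ d ∈ D, ∀ g : G, g • d = d → σ g d.1 * τ d = τ d * σ g d.2) :
    ∃ (f : V → P) (φ : G →* P), f v₀ = 1 ∧ (∀ d ∈ D, f d.2 = f d.1 * τ d) ∧
      (∀ g v, φ g = f (g • v) * σ g v * (f v)⁻¹) := by
  have hσ1 : ∀ v, σ 1 v = 1 := by
    intro v
    have := hσ 1 1 v
    simpa using this
  -- The translate of `τ` to the edge `g • d`; `hτ` makes it depend only on that edge.
  let F : G → V × V → P := fun g d => σ g d.1 * τ d * (σ g d.2)⁻¹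
  have hF : ∀ g g' : G, ∀ d ∈ D, ∀ d' ∈ D, g • d = g' • d' → F g d = F g' d' := by
    intro g g' d hd d' hd' h
    obtain ⟨u, rfl⟩ : ∃ u, g = g' * u := ⟨g'⁻¹ * g, by group⟩
    have h1 : u • d = d' := by rwa [mul_smul, smul_left_cancel_iff] at h
    obtain rfl := hD.eq_of_smul_eq d hd d' hd' _ h1
    have h2 := hτ d hd _ h1
    have e1 : u • d.1 = d.1 := congrArg Prod.fst h1
    have e2 : u • d.2 = d.2 := congrArg Prod.snd h1
    simp only [F]
    rw [hσ, hσ, e1, e2]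
    generalize σ u d.1 = x at *
    generalize σ u d.2 = y at *
    have h4 : x = τ d * y * (τ d)⁻¹ := by rw [← h2]; group
    rw [h4]; group
  have hFn : ∀ g g' : G, ∀ d ∈ D, ∀ d' ∈ D, g • d ≠ (g' • d').swap := by
    intro g g' d hd d' hd' h
    refine hD.smul_ne_swap d hd d' hd' (g'⁻¹ * g) ?_
    rw [mul_smul, h, Prod.smul_swap, inv_smul_smul]
  -- The function `c` extends `τ` to all oriented edges, with inverse values on reversed edges and
  -- the irrelevant value `1` on non-edges.
  have hex : ∀ v w, ∃ x : P, (∀ g, ∀ d ∈ D, g • d = (v, w) → x = F g d) ∧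
      (∀ g, ∀ d ∈ D, g • d = (w, v) → x = (F g d)⁻¹) := by
    intro v w
    by_cases h : ∃ g : G, ∃ d ∈ D, g • d = (v, w)
    · obtain ⟨g, d, hd, h⟩ := h
      refine ⟨F g d, fun g' d' hd' h' => hF _ _ _ hd _ hd' (h.trans h'.symm), fun g' d' hd' h' => ?_⟩
      exact (hFn g g' d hd d' hd' (by rw [h, h']; rfl)).elim
    · by_cases h' : ∃ g : G, ∃ d ∈ D, g • d = (w, v)
      · obtain ⟨g, d, hd, h'⟩ := h'
        refine ⟨(F g d)⁻¹, fun g' d' hd' h'' => (h ⟨_, _, hd', h''⟩).elim, fun g' d' hd' h'' => ?_⟩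
        rw [hF _ _ _ hd _ hd' (h'.trans h''.symm)]
      · exact ⟨1, fun g d hd e => (h ⟨_, _, hd, e⟩).elim, fun g d hd e => (h' ⟨_, _, hd, e⟩).elim⟩
  choose c hc1 hc2 using hex
  have hFs : ∀ g g' d, F (g * g') d = σ g (g' • d.1) * F g' d * (σ g (g' • d.2))⁻¹ := by
    intro g g' d
    simp only [F, hσ]; group
  have hcs : ∀ g v w, T.Adj v w → c (g • v) (g • w) = σ g v * c v w * (σ g w)⁻¹ := by
    intro g v w h
    obtain ⟨k, d, hd, e | e⟩ := hD.exists_smul v w h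
    · have e1 : k • d.1 = v := congrArg Prod.fst e
      have e2 : k • d.2 = w := congrArg Prod.snd e
      rw [hc1 v w k d hd e, hc1 (g • v) (g • w) (g * k) d hd (by rw [mul_smul, e]; rfl), hFs, e1, e2]
    · have e1 : k • d.1 = w := congrArg Prod.fst e
      have e2 : k • d.2 = v := congrArg Prod.snd e
      rw [hc2 v w k d hd e, hc2 (g • v) (g • w) (g * k) d hd (by rw [mul_smul, e]; rfl), hFs, e1, e2]
      group
  obtain ⟨f, hf0, hf⟩ := hT.exists_potential v₀ c (by
    intro v w h
    obtain ⟨k, d, hd, e | e⟩ := hD.exists_smul v w h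
    · rw [hc1 v w k d hd e, hc2 w v k d hd e]
    · rw [hc2 v w k d hd e, hc1 w v k d hd e, inv_inv])
  -- Equivariance of `c` (`hcs`) cancels the change of `f` along an edge, so this expression does
  -- not depend on the vertex and can serve as `φ g`.
  have hconst : ∀ g v w, f (g • v) * σ g v * (f v)⁻¹ = f (g • w) * σ g w * (f w)⁻¹ := by
    intro g
    refine hT.connected.eq_of_forall_adj (fun v => f (g • v) * σ g v * (f v)⁻¹) ?_
    intro v w h
    rw [hf _ _ (hadj g v w h), hcs g v w h, hf v w h]
    group
  refine ⟨f, ⟨⟨fun g => f (g • v₀) * σ g v₀ * (f v₀)⁻¹, ?_⟩, ?_⟩, hf0, ?_, ?_⟩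
  · simp [hσ1]
  · intro g h
    change f _ * _ * _ = (f _ * _ * _) * (f _ * _ * _)
    rw [hconst g v₀ (h • v₀), hσ, mul_smul]
    group
  · intro d hd
    rw [hf _ _ (hD.adj d hd), hc1 d.1 d.2 1 d hd (one_smul _ _)]
    simp [F, hσ1]
  · intro g v
    exact hconst g v₀ v

end TreeCocycles

/-! ### Connected transversals for vertices and edges. -/

section FundamentalDomain

variable {G : Type*} [Group G] {V : Type*} [MulAction G V] {T : SimpleGraph V}

/-- `R` is a set of representatives of the orbits of vertices, connected inside `T`. -/
structure IsConnectedTransversal (G : Type*) [Group G] {V : Type*} [MulAction G V]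
    (T : SimpleGraph V) (v₀ : V) (R : Set V) : Prop where
  eq_of_smul_eq : ∀ r ∈ R, ∀ r' ∈ R, ∀ g : G, g • r = r' → r = r'
  base_mem : v₀ ∈ R
  exists_smul_mem : ∀ v : V, ∃ g : G, g • v ∈ R
  connected : ∀ r ∈ R, Relation.ReflTransGen (fun x y => T.Adj x y ∧ x ∈ R ∧ y ∈ R) v₀ r

theorem finite_orbitRel_quotient (hV : ∃ F : Set V, F.Finite ∧ ∀ v : V, ∃ g : G, g • v ∈ F) :
    Finite (MulAction.orbitRel.Quotient G V) := by
  obtain ⟨F, hF, h⟩ := hV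
  have := hF.to_subtype
  refine Finite.of_surjective (fun x : F => (Quotient.mk'' x.1 : MulAction.orbitRel.Quotient G V)) ?_
  intro q
  induction q using Quotient.inductionOn' with
  | h v =>
    obtain ⟨g, hg⟩ := h v
    exact ⟨⟨g • v, hg⟩, Quotient.sound' ⟨g, rfl⟩⟩

/-- Take a connected partial transversal meeting a maximal set of orbits. If an orbit were missed, a
path to it would have an edge leaving the saturation of `R`; translating the start of that edge into
`R` and adding its end contradicts maximality. -/
theorem exists_isConnectedTransversal (hT : T.Connected)
    (hadj : ∀ (g : G) (v w : V), T.Adj v w → T.Adj (g • v) (g • w))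
    (hV : ∃ F : Set V, F.Finite ∧ ∀ v : V, ∃ g : G, g • v ∈ F) (v₀ : V) :
    ∃ R : Set V, R.Finite ∧ IsConnectedTransversal G T v₀ R := by
  have hfin := finite_orbitRel_quotient hV
  let π : V → MulAction.orbitRel.Quotient G V := Quotient.mk''
  have hπ : ∀ v w, π v = π w ↔ ∃ g : G, g • w = v := fun v w => Quotient.eq''
  let 𝒢 : Set (Set V) := {R | v₀ ∈ R ∧ Set.InjOn π R ∧
    ∀ r ∈ R, Relation.ReflTransGen (fun x y => T.Adj x y ∧ x ∈ R ∧ y ∈ R) v₀ r}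
  obtain ⟨R, ⟨h0, hinj, hconn⟩, hmax⟩ := Set.Finite.exists_maximalFor' (fun R => π '' R) 𝒢
    (Set.toFinite _) ⟨{v₀}, rfl, by simp, by
      rintro r rfl
      exact Relation.ReflTransGen.refl⟩
  refine ⟨R, Set.Finite.of_finite_image (Set.toFinite _) hinj, ?_, h0, ?_, hconn⟩
  · intro r hr r' hr' g h
    exact (hinj hr' hr ((hπ _ _).2 ⟨g, h⟩)).symm
  · by_contra! hcon
    obtain ⟨u, hu⟩ := hcon
    let A : Set V := {v | ∃ g : G, g • v ∈ R}
    obtain ⟨p⟩ := hT.preconnected v₀ u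
    obtain ⟨d, -, ⟨g, hg⟩, hdn⟩ := p.exists_boundary_dart A ⟨1, by simpa using h0⟩
      (fun ⟨g, hg⟩ => hu g hg)
    have hy : ∀ k : G, k • (g • d.snd) ∉ R := fun k hk => hdn ⟨k * g, by rwa [mul_smul]⟩
    have hnew : π (g • d.snd) ∉ π '' R := by
      rintro ⟨r, hr, h⟩
      obtain ⟨k, hk⟩ := (hπ _ _).1 h
      exact hy k (hk ▸ hr)
    have hR' : insert (g • d.snd) R ∈ 𝒢 := by
      refine ⟨Or.inr h0, ?_, ?_⟩
      · refine (Set.injOn_insert (fun h => hy 1 (by rwa [one_smul]))).2 ⟨hinj, hnew⟩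
      · have hmono : ∀ r ∈ R, Relation.ReflTransGen (fun x y => T.Adj x y ∧
            x ∈ insert (g • d.snd) R ∧ y ∈ insert (g • d.snd) R) v₀ r := fun r hr =>
          Relation.ReflTransGen.mono (fun x y h => ⟨h.1, Or.inr h.2.1, Or.inr h.2.2⟩) _ _ (hconn r hr)
        rintro r (rfl | hr)
        · exact (hmono _ hg).tail ⟨hadj g _ _ d.adj, Or.inr hg, Or.inl rfl⟩
        · exact hmono r hr
    exact hnew (hmax hR' (Set.image_mono (Set.subset_insert _ _)) ⟨_, Or.inl rfl, rfl⟩)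

/-- One edge is chosen in each unoriented orbit, inside `R` whenever possible. Since `R` meets each
vertex orbit once, edges inside `R` in the same orbit agree up to orientation, which gives the last
clause. -/
theorem IsConnectedTransversal.exists_isEdgeTransversal {v₀ : V} {R : Set V}
    (hR : IsConnectedTransversal G T v₀ R)
    (hadj : ∀ (g : G) (v w : V), T.Adj v w → T.Adj (g • v) (g • w))
    (hinv : ∀ (g : G) (v w : V), T.Adj v w → ¬ (g • v = w ∧ g • w = v))
    (hE : ∃ F : Set (V × V), F.Finite ∧ ∀ v w : V, T.Adj v w → ∃ g : G, (g • v, g • w) ∈ F) :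
    ∃ D : Set (V × V), D.Finite ∧ IsEdgeTransversal G T D ∧ (∀ d ∈ D, d.1 ∈ R) ∧
      ∀ x ∈ R, ∀ y ∈ R, T.Adj x y → (x, y) ∈ D ∨ (y, x) ∈ D := by
  let S : Setoid (V × V) :=
    { r := fun e e' => ∃ g : G, g • e = e' ∨ g • e = e'.swap
      iseqv := by
        refine ⟨fun e => ⟨1, Or.inl (one_smul _ _)⟩, ?_, ?_⟩
        · rintro e e' ⟨g, h | h⟩
          · exact ⟨g⁻¹, Or.inl (by rw [← h, inv_smul_smul])⟩
          · exact ⟨g⁻¹, Or.inr (by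
              rw [← Prod.swap_swap e', ← h, ← Prod.smul_swap, inv_smul_smul])⟩
        · rintro a b c ⟨g, h | h⟩ ⟨k, h' | h'⟩
          · exact ⟨k * g, Or.inl (by rw [mul_smul, h, h'])⟩
          · exact ⟨k * g, Or.inr (by rw [mul_smul, h, h'])⟩
          · exact ⟨k * g, Or.inr (by rw [mul_smul, h, ← Prod.smul_swap, h'])⟩
          · exact ⟨k * g, Or.inl (by rw [mul_smul, h, ← Prod.smul_swap, h', Prod.swap_swap])⟩ }
  have hS : ∀ e e' : V × V, (Quotient.mk S e = Quotient.mk S e') ↔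
      ∃ g : G, g • e = e' ∨ g • e = e'.swap := fun e e' => Quotient.eq
  have hsa : ∀ (g : G) (e : V × V), T.Adj e.1 e.2 → T.Adj (g • e).1 (g • e).2 :=
    fun g e h => hadj g _ _ h
  let I : Set (Quotient S) := {q | ∃ e : V × V, T.Adj e.1 e.2 ∧ Quotient.mk S e = q}
  have hI : I.Finite := by
    obtain ⟨F, hF, h⟩ := hE
    refine (hF.image (Quotient.mk S)).subset ?_
    rintro q ⟨e, he, rfl⟩
    obtain ⟨g, hg⟩ := h e.1 e.2 he
    exact ⟨_, hg, ((hS _ _).2 ⟨g, Or.inl rfl⟩).symm⟩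
  have hex : ∀ q : Quotient S, ∃ d : V × V, q ∈ I → T.Adj d.1 d.2 ∧ Quotient.mk S d = q ∧ d.1 ∈ R ∧
      ((∃ x ∈ R, ∃ y ∈ R, T.Adj x y ∧ Quotient.mk S (x, y) = q) → d.2 ∈ R) := by
    intro q
    by_cases h : ∃ x ∈ R, ∃ y ∈ R, T.Adj x y ∧ Quotient.mk S (x, y) = q
    · obtain ⟨x, hx, y, hy, hxy, hq⟩ := h
      exact ⟨(x, y), fun _ => ⟨hxy, hq, hx, fun _ => hy⟩⟩
    · by_cases hq : q ∈ I
      · obtain ⟨e, he, rfl⟩ := hq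
        obtain ⟨g, hg⟩ := hR.exists_smul_mem e.1
        exact ⟨g • e, fun _ => ⟨hsa g e he, ((hS _ _).2 ⟨g, Or.inl rfl⟩).symm, hg,
          fun h' => (h h').elim⟩⟩
      · exact ⟨(v₀, v₀), fun h => (hq h).elim⟩
  choose ρ hρ using hex
  have hclass : ∀ d ∈ ρ '' I, ρ (Quotient.mk S d) = d := by
    rintro _ ⟨q, hq, rfl⟩
    rw [(hρ q hq).2.1]
  have hmem : ∀ v w, T.Adj v w → Quotient.mk S (v, w) ∈ I := fun v w h => ⟨(v, w), h, rfl⟩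
  refine ⟨ρ '' I, hI.image _, ⟨?_, ?_, ?_, ?_⟩, ?_, ?_⟩
  · rintro _ ⟨q, hq, rfl⟩
    exact (hρ q hq).1
  · intro v w h
    obtain ⟨g, hg⟩ := (hS _ _).1 (hρ _ (hmem v w h)).2.1
    exact ⟨g, _, ⟨_, hmem v w h, rfl⟩, hg⟩
  · intro d hd d' hd' g h
    rw [← hclass d hd, ← hclass d' hd', (hS d d').2 ⟨g, Or.inl h⟩]
  · intro d hd d' hd' g h
    obtain rfl : d = d' := by
      rw [← hclass d hd, ← hclass d' hd', (hS d d').2 ⟨g, Or.inr h⟩]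
    obtain ⟨q, hq, rfl⟩ := hd
    exact hinv g _ _ (hρ q hq).1 ⟨congrArg Prod.fst h, congrArg Prod.snd h⟩
  · rintro _ ⟨q, hq, rfl⟩
    exact (hρ q hq).2.2.1
  · intro x hx y hy h
    obtain ⟨-, h1, h2, h3⟩ := hρ _ (hmem x y h)
    have h4 := h3 ⟨x, hx, y, hy, h, rfl⟩
    obtain ⟨g, hg | hg⟩ := (hS _ _).1 h1
    · left
      refine ⟨_, hmem x y h, Prod.ext ?_ ?_⟩
      · exact hR.eq_of_smul_eq _ h2 _ hx g (congrArg Prod.fst hg)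
      · exact hR.eq_of_smul_eq _ h4 _ hy g (congrArg Prod.snd hg)
    · right
      refine ⟨_, hmem x y h, Prod.ext ?_ ?_⟩
      · exact hR.eq_of_smul_eq _ h2 _ hy g (congrArg Prod.fst hg)
      · exact hR.eq_of_smul_eq _ h4 _ hx g (congrArg Prod.snd hg)

/-- A choice, for each vertex `v`, of its representative `s v ∈ R` and of `k v` with
`k v • s v = v`. -/
theorem IsConnectedTransversal.exists_section {v₀ : V} {R : Set V}
    (hR : IsConnectedTransversal G T v₀ R) :
    ∃ (s : V → V) (k : V → G), (∀ v, s v ∈ R) ∧ (∀ v, k v • s v = v) ∧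
      (∀ r ∈ R, s r = r ∧ k r = 1) ∧ ∀ (g : G) v, s (g • v) = s v := by
  have hex : ∀ v, ∃ g : G, g⁻¹ • v ∈ R ∧ (v ∈ R → g = 1) := by
    intro v
    by_cases hv : v ∈ R
    · exact ⟨1, by simpa using hv, fun _ => rfl⟩
    · obtain ⟨g, hg⟩ := hR.exists_smul_mem v
      exact ⟨g⁻¹, by simpa using hg, fun h => (hv h).elim⟩
  choose k hk hk1 using hex
  refine ⟨fun v => (k v)⁻¹ • v, k, hk, fun v => smul_inv_smul _ _, fun r hr => ?_, fun g v => ?_⟩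
  · simp [hk1 r hr]
  · refine hR.eq_of_smul_eq _ (hk _) _ (hk _) ((k v)⁻¹ * g⁻¹ * k (g • v)) ?_
    simp [mul_smul]

end FundamentalDomain

/-! ### Conjugacy of free actions of a finite group. -/

section FreeActions

variable {S : Type*} {X : Type v} [Group S]

/-- A free action is a disjoint union of copies of the regular one, indexed by its orbits; each
orbit is parametrised from a chosen base point. -/
theorem exists_equiv_prod_of_free (α : S →* Equiv.Perm X) (hα : ∀ s x, α s x = x → s = 1) :
    ∃ (Ω : Type v) (e : Ω × S ≃ X), ∀ ω s t, e (ω, s * t) = α s (e (ω, t)) := by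
  let _ : MulAction S X := MulAction.compHom X α
  refine ⟨MulAction.orbitRel.Quotient S X, Equiv.ofBijective (fun p => α p.2 p.1.out) ⟨?_, ?_⟩, ?_⟩
  · rintro ⟨ω, s⟩ ⟨ω', s'⟩ h
    simp only at h
    have hω : ω = ω' := by
      rw [← Quotient.out_eq' ω, ← Quotient.out_eq' ω']
      refine Quotient.sound' ⟨s⁻¹ * s', ?_⟩
      change α (s⁻¹ * s') _ = _
      rw [map_mul, Equiv.Perm.mul_apply, ← h, ← Equiv.Perm.mul_apply, ← map_mul,
        inv_mul_cancel, map_one, Equiv.Perm.one_apply]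
    subst hω
    have : s'⁻¹ * s = 1 := by
      apply hα _ ω.out
      rw [map_mul, Equiv.Perm.mul_apply, h, ← Equiv.Perm.mul_apply, ← map_mul,
        inv_mul_cancel, map_one, Equiv.Perm.one_apply]
    rw [inv_mul_eq_one] at this
    rw [this]
  · intro x
    obtain ⟨s, hs⟩ : ∃ s : S, s • (Quotient.mk'' x : MulAction.orbitRel.Quotient S X).out = x := by
      have : (Quotient.mk'' x : MulAction.orbitRel.Quotient S X) =
        Quotient.mk'' (Quotient.mk'' x : MulAction.orbitRel.Quotient S X).out :=
        (Quotient.out_eq' _).symm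
      exact Quotient.eq''.1 this
    exact ⟨⟨_, s⟩, hs⟩
  · intro ω s t
    change α (s * t) _ = α s (α t _)
    rw [map_mul, Equiv.Perm.mul_apply]

/-- Two free actions of a finite group on the same finite set are conjugate. -/
theorem exists_perm_intertwining [Finite S] [Finite X] (α β : S →* Equiv.Perm X)
    (hα : ∀ s x, α s x = x → s = 1) (hβ : ∀ s x, β s x = x → s = 1) :
    ∃ τ : Equiv.Perm X, ∀ s, α s * τ = τ * β s := by
  obtain ⟨Ω, e, he⟩ := exists_equiv_prod_of_free α hα
  obtain ⟨Ω', e', he'⟩ := exists_equiv_prod_of_free β hβ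
  have : Finite Ω := Finite.of_injective (fun ω => e (ω, 1)) fun a b h => by simpa using h
  have : Finite Ω' := Finite.of_injective (fun ω => e' (ω, 1)) fun a b h => by simpa using h
  have hcard : Nat.card Ω = Nat.card Ω' := by
    have h : Nat.card (Ω × S) = Nat.card (Ω' × S) := Nat.card_congr (e.trans e'.symm)
    rw [Nat.card_prod, Nat.card_prod] at h
    exact Nat.eq_of_mul_eq_mul_right Nat.card_pos h
  obtain ⟨q⟩ : Nonempty (Ω' ≃ Ω) := Finite.card_eq.1 hcard.symm
  refine ⟨e'.symm.trans ((q.prodCongr (Equiv.refl S)).trans e), fun s => ?_⟩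
  ext x
  obtain ⟨⟨ω, t⟩, rfl⟩ := e'.surjective x
  simp [← he, ← he']

end FreeActions

/-! ### A finite quotient that separates the edge groups. -/

section FiniteQuotient

variable {G : Type u} [Group G] {V : Type v} [MulAction G V] {P : Type*} [Group P]

theorem section_cocycle {s : V → V} {k : V → G} (hk : ∀ v, k v • s v = v)
    (hs : ∀ (g : G) v, s (g • v) = s v) (g : G) (v : V) :
    ((k (g • v))⁻¹ * g * k v) • s v = s v := by
  rw [mul_smul, mul_smul, hk, inv_smul_eq_iff]
  conv_rhs => rw [← hs g v]
  exact (hk _).symm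

/-- Moving `v` and `g • v` back to their common representative turns `g` into an element of the
stabiliser of `s v`. Thus maps `ι r` multiplicative only on the stabiliser of `r` combine into a
cocycle on all of `G`. -/
theorem cocycle_of_section {s : V → V} {k : V → G} (hk : ∀ v, k v • s v = v)
    (hs : ∀ (g : G) v, s (g • v) = s v) (ι : V → G → P)
    (hι : ∀ v g h, g • v = v → h • v = v → ι v (g * h) = ι v g * ι v h) (g h : G) (v : V) :
    ι (s v) ((k ((g * h) • v))⁻¹ * (g * h) * k v) =
      ι (s (h • v)) ((k (g • h • v))⁻¹ * g * k (h • v)) *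
        ι (s v) ((k (h • v))⁻¹ * h * k v) := by
  have h1 := section_cocycle hk hs g (h • v)
  rw [hs] at h1 ⊢
  rw [← hι _ _ _ h1 (section_cocycle hk hs h v), mul_smul]
  congr 1
  group

/-- If each vertex stabiliser has a normal subgroup of finite index meeting the incident edge
groups trivially, then there is a homomorphism to a finite group whose kernel meets the vertex
stabilisers in conjugates of subgroups of the given ones. -/
theorem exists_hom_finite_of_edge_trivial {T : SimpleGraph V} (hT : T.IsTree)
    (hadj : ∀ (g : G) (v w : V), T.Adj v w → T.Adj (g • v) (g • w))
    (hinv : ∀ (g : G) (v w : V), T.Adj v w → ¬ (g • v = w ∧ g • w = v))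
    (hV : ∃ F : Set V, F.Finite ∧ ∀ v : V, ∃ g : G, g • v ∈ F)
    (hE : ∃ F : Set (V × V), F.Finite ∧ ∀ v w : V, T.Adj v w → ∃ g : G, (g • v, g • w) ∈ F)
    (hfe : ∀ v w : V, T.Adj v w →
      Finite (MulAction.stabilizer G v ⊓ MulAction.stabilizer G w : Subgroup G))
    (N : ∀ v : V, Subgroup (MulAction.stabilizer G v)) (hNn : ∀ v, (N v).Normal)
    (hNf : ∀ v, (N v).FiniteIndex)
    (hN : ∀ v w : V, T.Adj v w → ∀ g : MulAction.stabilizer G v, g ∈ N v →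
      (g : G) • w = w → g = 1) :
    ∃ (Q : Type (max u v)) (_ : Group Q) (_ : Finite Q) (φ : G →* Q) (s : V → V) (k : V → G),
      (∀ v, k v • s v = v) ∧ ∀ (v : V) (g : G), g • v = v → φ g = 1 →
        ∃ h ∈ N (s v), (h : G) = (k v)⁻¹ * g * k v := by
  classical
  obtain ⟨v₀⟩ := hT.connected.nonempty
  obtain ⟨R, hRf, hR⟩ := exists_isConnectedTransversal hT.connected hadj hV v₀
  obtain ⟨D, -, hD, -, -⟩ := hR.exists_isEdgeTransversal hadj hinv hE
  obtain ⟨s, k, hsR, hk, -, hs⟩ := hR.exists_section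
  have := hRf.to_subtype
  let X := ∀ r : R, MulAction.stabilizer G (r : V) ⧸ N r
  let ι : V → G → Equiv.Perm X := fun r g =>
    if h : r ∈ R ∧ g • r = r then MulAction.toPermHom X X
      (Pi.mulSingle ⟨r, h.1⟩ (QuotientGroup.mk (⟨g, h.2⟩ : MulAction.stabilizer G r))) else 1
  have hι : ∀ v g h, g • v = v → h • v = v → ι v (g * h) = ι v g * ι v h := by
    intro r g h hg hh
    by_cases hr : r ∈ R
    · have hgh : (g * h) • r = r := by rw [mul_smul, hh, hg]
      simp only [ι, dif_pos (And.intro hr hg), dif_pos (And.intro hr hh),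
        dif_pos (And.intro hr hgh)]
      rw [← map_mul, ← Pi.mulSingle_mul]
      rfl
    · simp [ι, hr]
  have hιN : ∀ r ∈ R, ∀ g, g • r = r → ∀ x : X, ι r g x = x → ∃ h ∈ N r, (h : G) = g := by
    intro r hr g hg x hx
    simp only [ι, dif_pos (And.intro hr hg)] at hx
    have h1 : (Pi.mulSingle ⟨r, hr⟩ (QuotientGroup.mk (⟨g, hg⟩ : MulAction.stabilizer G r)) : X)
        * x = x := hx
    rw [mul_eq_right, Pi.mulSingle_eq_one_iff, QuotientGroup.eq_one_iff] at h1
    exact ⟨_, h1, rfl⟩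
  let σ : G → V → Equiv.Perm X := fun g v => ι (s v) ((k (g • v))⁻¹ * g * k v)
  have hσ : ∀ g h v, σ (g * h) v = σ g (h • v) * σ h v := cocycle_of_section hk hs ι hι
  have hσN : ∀ (g : G) v, g • v = v → ∀ x : X, σ g v x = x →
      ∃ h ∈ N (s v), (h : G) = (k v)⁻¹ * g * k v := by
    intro g v hg x hx
    have h1 := section_cocycle hk hs g v
    have h2 := hιN _ (hsR v) _ h1 x hx
    rwa [hg] at h2
  -- A fixed point in `X` forces the conjugate of `g` into `N (s v)`, which meets the groups of
  -- edges at `s v` trivially.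
  have hfree : ∀ v w, T.Adj v w → ∀ g : G, g • v = v → g • w = w → ∀ x : X, σ g v x = x →
      g = 1 := by
    intro v w h g hv hw x hx
    obtain ⟨u, hu, hug⟩ := hσN g v hv x hx
    have h1 : T.Adj (s v) ((k v)⁻¹ • w) := by
      have := hadj (k v)⁻¹ v w h
      rwa [inv_smul_eq_iff.2 (hk v).symm] at this
    have h2 := hN _ _ h1 u hu (by rw [hug, mul_smul, mul_smul, smul_inv_smul, hw])
    rw [h2, Subgroup.coe_one, mul_assoc, eq_inv_mul_iff_mul_eq, mul_one, right_eq_mul] at hug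
    exact hug
  have hfin : Finite X := Pi.finite
  have hτ : ∀ d : V × V, ∃ τ : Equiv.Perm X, d ∈ D → ∀ g : G, g • d = d →
      σ g d.1 * τ = τ * σ g d.2 := by
    rintro ⟨a, b⟩
    by_cases hd : (a, b) ∈ D
    · have hab : T.Adj a b := hD.adj _ hd
      let S : Subgroup G := MulAction.stabilizer G a ⊓ MulAction.stabilizer G b
      have hSf : Finite S := hfe a b hab
      have hSa : ∀ g : S, (g : G) • a = a := fun g => g.2.1
      have hSb : ∀ g : S, (g : G) • b = b := fun g => g.2.2
      let α : S →* Equiv.Perm X := MonoidHom.mk' (fun g => σ g a) fun g h => by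
        rw [Subgroup.coe_mul, hσ, hSa]
      let β : S →* Equiv.Perm X := MonoidHom.mk' (fun g => σ g b) fun g h => by
        rw [Subgroup.coe_mul, hσ, hSb]
      obtain ⟨τ, hτ⟩ := exists_perm_intertwining α β
        (fun g x h => Subtype.ext (hfree a b hab g (hSa g) (hSb g) x h))
        (fun g x h => Subtype.ext (hfree b a hab.symm g (hSb g) (hSa g) x h))
      exact ⟨τ, fun _ g hg => hτ ⟨g, congrArg Prod.fst hg, congrArg Prod.snd hg⟩⟩
    · exact ⟨1, fun h => (hd h).elim⟩
  choose τ hτ using hτ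
  obtain ⟨f, φ, -, -, hφ⟩ := exists_hom_of_cocycle hT hadj hD v₀ σ hσ τ hτ
  refine ⟨Equiv.Perm X, inferInstance, inferInstance, φ, s, k, hk, fun v g hg h1 => ?_⟩
  -- For `g` fixing `v`, `φ g` is conjugate to `σ g v`. If it is trivial, then `σ g v` fixes every
  -- point of `X`, in particular `1`.
  rw [hφ g v, hg, mul_inv_eq_one, mul_eq_left] at h1
  exact hσN g v hg 1 (by rw [h1]; rfl)

end FiniteQuotient

/-! ### Actions with trivial edge groups and free products. -/

section FreeSplitting

/-- A group acting on a tree with trivial edge groups and finitely many orbits of vertices and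
edges is the free product of representatives of its non-trivial vertex groups and a free group of
finite rank. -/
theorem isFreeProductOneEndedFree_of_trivial_edge_groups {G : Type u} [Group G] {V : Type v}
    [MulAction G V] {T : SimpleGraph V} (hT : T.IsTree)
    (hadj : ∀ (g : G) (v w : V), T.Adj v w → T.Adj (g • v) (g • w))
    (hinv : ∀ (g : G) (v w : V), T.Adj v w → ¬ (g • v = w ∧ g • w = v))
    (hV : ∃ F : Set V, F.Finite ∧ ∀ v : V, ∃ g : G, g • v ∈ F)
    (hE : ∃ F : Set (V × V), F.Finite ∧ ∀ v w : V, T.Adj v w → ∃ g : G, (g • v, g • w) ∈ F)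
    (htriv : ∀ v w : V, T.Adj v w → ∀ g : G, g • v = v → g • w = w → g = 1)
    (hone : ∀ v : V, MulAction.stabilizer G v = ⊥ ∨ IsOneEnded (MulAction.stabilizer G v)) :
    IsFreeProductOneEndedFree G := by
  classical
  obtain ⟨v₀⟩ := hT.connected.nonempty
  obtain ⟨R, hRf, hR⟩ := exists_isConnectedTransversal hT.connected hadj hV v₀
  obtain ⟨D, hDf, hD, hDR, hRD⟩ := hR.exists_isEdgeTransversal hadj hinv hE
  obtain ⟨s, k, hsR, hk, hkR, hs⟩ := hR.exists_section
  have := (hRf.subset (Set.sep_subset R fun r => MulAction.stabilizer G r ≠ ⊥)).to_subtype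
  have := (hDf.subset (Set.sep_subset D fun d => d.2 ∉ R)).to_subtype
  obtain ⟨m, ⟨e⟩⟩ := Finite.exists_equiv_fin {r ∈ R | MulAction.stabilizer G r ≠ ⊥}
  obtain ⟨n, ⟨b⟩⟩ := Finite.exists_equiv_fin {d ∈ D | d.2 ∉ R}
  let x : Fin m → V := fun i => (e.symm i : V)
  have hxR : ∀ i, x i ∈ R := fun i => (e.symm i).2.1
  have hx : ∀ r ∈ R, MulAction.stabilizer G r ≠ ⊥ → ∃ i, x i = r := fun r hr h =>
    ⟨e ⟨r, hr, h⟩, by simp [x]⟩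
  have hxi : Function.Injective x := Subtype.val_injective.comp e.symm.injective
  let H : Fin m → Subgroup G := fun i => MulAction.stabilizer G (x i)
  let t : FreeGroup (Fin n) →* G := FreeGroup.lift fun i => k (b.symm i : V × V).2
  let P := Monoid.Coprod (Monoid.CoprodI fun i => H i) (FreeGroup (Fin n))
  let ψ : P →* G := Monoid.Coprod.lift (Monoid.CoprodI.lift fun i => (H i).subtype) t
  let inH : ∀ i, H i →* P := fun i =>
    Monoid.Coprod.inl.comp (Monoid.CoprodI.of (M := fun i => H i) (i := i))
  have hψH : ∀ i (h : H i), ψ (inH i h) = h := by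
    intro i h
    exact (Monoid.Coprod.lift_apply_inl _ _ _).trans (Monoid.CoprodI.lift_of _ _)
  have hψt : ∀ i, ψ (Monoid.Coprod.inr (FreeGroup.of i)) = k (b.symm i : V × V).2 := fun i =>
    (Monoid.Coprod.lift_apply_inr _ _ _).trans FreeGroup.lift_apply_of
  have hex : ∀ r g, ∃ p : P, (∀ i, x i = r → ∀ hg : g ∈ H i, p = inH i ⟨g, hg⟩) ∧
      ((¬ ∃ i, x i = r) → p = 1) := by
    intro r g
    by_cases h : ∃ i, x i = r ∧ g ∈ H i
    · obtain ⟨i, rfl, hg⟩ := h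
      refine ⟨inH i ⟨g, hg⟩, fun j hj => ?_, fun h => (h ⟨i, rfl⟩).elim⟩
      obtain rfl := hxi hj
      exact fun _ => rfl
    · exact ⟨1, fun i hi hg => (h ⟨i, hi, hg⟩).elim, fun _ => rfl⟩
  choose ι hι1 hι2 using hex
  have hι : ∀ v g h, g • v = v → h • v = v → ι v (g * h) = ι v g * ι v h := by
    intro r g h hg hh
    by_cases hr : ∃ i, x i = r
    · obtain ⟨i, rfl⟩ := hr
      rw [hι1 _ g i rfl hg, hι1 _ h i rfl hh, hι1 _ (g * h) i rfl (mul_mem hg hh), ← map_mul]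
      rfl
    · simp [hι2 _ _ hr]
  have hψι : ∀ r ∈ R, ∀ g, g • r = r → ψ (ι r g) = g := by
    intro r hr g hg
    by_cases h : ∃ i, x i = r
    · obtain ⟨i, rfl⟩ := h
      rw [hι1 _ g i rfl hg, hψH]
    · rw [hι2 _ _ h, map_one]
      have h1 : MulAction.stabilizer G r = ⊥ := by
        by_contra h2
        exact h (hx r hr h2)
      have h2 : g ∈ MulAction.stabilizer G r := hg
      rw [h1, Subgroup.mem_bot] at h2
      exact h2.symm
  let σ : G → V → P := fun g v => ι (s v) ((k (g • v))⁻¹ * g * k v)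
  have hσ : ∀ g h v, σ (g * h) v = σ g (h • v) * σ h v := cocycle_of_section hk hs ι hι
  have hψσ : ∀ g v, ψ (σ g v) = (k (g • v))⁻¹ * g * k v := fun g v =>
    hψι _ (hsR v) _ (section_cocycle hk hs g v)
  -- Edges leaving `R` carry the free generators (stable letters). Edges inside `R` carry `1`, which
  -- forces `f = 1` on the connected set `R`.
  let τ : V × V → P := fun d => if h : d ∈ {d ∈ D | d.2 ∉ R} then
    Monoid.Coprod.inr (FreeGroup.of (b ⟨d, h⟩)) else 1
  have hψτ : ∀ d ∈ D, ψ (τ d) = k d.2 := by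
    intro d hd
    by_cases h : d ∈ {d ∈ D | d.2 ∉ R}
    · simp only [τ, dif_pos h]
      rw [hψt, b.symm_apply_apply]
    · simp only [τ, dif_neg h]
      rw [(hkR d.2 (by by_contra h'; exact h ⟨hd, h'⟩)).2, map_one]
  obtain ⟨f, φ, hf0, hf, hφ⟩ := exists_hom_of_cocycle hT hadj hD v₀ σ hσ τ (by
    intro d hd g hg
    obtain rfl := htriv d.1 d.2 (hD.adj d hd) g (congrArg Prod.fst hg) (congrArg Prod.snd hg)
    have h1 : ∀ v, σ 1 v = 1 := fun v => by simpa using hσ 1 1 v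
    simp [h1])
  have hfR : ∀ r ∈ R, f r = 1 := by
    intro r hr
    have h := hR.connected r hr
    induction h with
    | refl => exact hf0
    | tail _ h ih =>
      obtain ⟨ha, hx', hy⟩ := h
      rcases hRD _ hx' _ hy ha with h | h
      · have := hf _ h
        simpa [τ, hy, ih hx'] using this
      · have := hf _ h
        simpa [τ, hx', ih hx'] using this.symm
  have hc : ∀ g v, ψ (f (g • v)) * (k (g • v))⁻¹ = ψ (φ g) * (ψ (f v) * (k v)⁻¹) * g⁻¹ := by
    intro g v
    rw [hφ g v, map_mul, map_mul, hψσ, map_inv]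
    group
  -- This quantity takes equal values at the ends of each `d ∈ D` by `hψτ`, hence by `hc` at the
  -- ends of every edge; so it keeps its value at `v₀`.
  have hc1 : ∀ v, ψ (f v) * (k v)⁻¹ = 1 := by
    intro v
    have h1 : ψ (f v₀) * (k v₀)⁻¹ = 1 := by simp [hf0, (hkR v₀ hR.base_mem).2]
    rw [← h1]
    refine hT.connected.eq_of_forall_adj (fun v => ψ (f v) * (k v)⁻¹) ?_ v v₀
    have hd : ∀ d ∈ D, ∀ g : G, ψ (f (g • d).1) * (k (g • d).1)⁻¹ =
        ψ (f (g • d).2) * (k (g • d).2)⁻¹ := by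
      intro d hd g
      rw [Prod.smul_fst, Prod.smul_snd, hc, hc, hf d hd, map_mul, hψτ d hd,
        (hkR d.1 (hDR d hd)).2]
      group
    intro v w h
    obtain ⟨g, d, hdD, h | h⟩ := hD.exists_smul v w h
    · simpa [h] using hd d hdD g
    · simpa [h] using (hd d hdD g).symm
  have hψφ : ∀ g, ψ (φ g) = g := by
    intro g
    have := hc g v₀
    rw [hc1, hc1, mul_one] at this
    exact (mul_inv_eq_one.1 this.symm)
  -- Checked on generators: at the fixed vertex `x i` for an element of `H i`, and at `s d.2` for
  -- the stable letter `k d.2`, which carries `s d.2` to `d.2`.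
  have hφψ : φ.comp ψ = MonoidHom.id P := by
    refine Monoid.Coprod.hom_ext (Monoid.CoprodI.ext_hom _ _ fun i => ?_)
      (FreeGroup.ext_hom _ _ fun i => ?_)
    · ext h
      change φ (ψ (inH i h)) = inH i h
      have hh : (h : G) • x i = x i := h.2
      obtain ⟨h1, h2⟩ := hkR _ (hxR i)
      rw [hψH, hφ _ (x i), hh, hfR _ (hxR i), one_mul, inv_one, mul_one]
      simp only [σ]
      rw [h1, hh, h2, inv_one, one_mul, mul_one, hι1 _ _ i rfl h.2]
    · obtain ⟨⟨d, hd⟩, rfl⟩ := b.surjective i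
      have h1 : ψ (Monoid.Coprod.inr (FreeGroup.of (b ⟨d, hd⟩))) = k d.2 := by
        rw [hψt, b.symm_apply_apply]
      change φ (ψ (Monoid.Coprod.inr (FreeGroup.of (b ⟨d, hd⟩)))) =
        Monoid.Coprod.inr (FreeGroup.of (b ⟨d, hd⟩))
      obtain ⟨h2, h3⟩ := hkR _ (hsR d.2)
      have h4 : ∀ r, ι r 1 = 1 := fun r => by
        simpa using hι r 1 1 (one_smul _ _) (one_smul _ _)
      rw [h1, hφ _ (s d.2), hk, hfR _ (hsR d.2), inv_one, mul_one, hf d hd.1,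
        hfR _ (hDR d hd.1), one_mul]
      simp only [σ, hk, h3, mul_one, inv_mul_cancel, h4]
      simp only [τ, dif_pos hd]
  refine ⟨m, n, H, t, fun i => ?_, ?_, fun g => ⟨φ g, hψφ g⟩⟩
  · exact (hone (x i)).resolve_left (e.symm i).2.2
  · exact Function.LeftInverse.injective (g := φ) fun p => DFunLike.congr_fun hφψ p

end FreeSplitting

/-! ### Ends, almost invariant sets and finite-index subgroups. -/

section Ends

open SimpleGraph

theorem infinite_supp_of_mem_end {V : Type u} {Γ : SimpleGraph V}
    {e : ∀ K, Γ.componentComplFunctor.obj K} (he : e ∈ Γ.end) (K : (Finset V)ᵒᵖ) :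
    (e K).supp.Infinite :=
  (e K).infinite_iff_in_all_ranges.mpr fun L h =>
    ⟨e (Opposite.op L), he (CategoryTheory.opHomOfLE (x := K) (y := Opposite.op L) h)⟩

/-- In a locally finite connected graph, every infinite set of vertices accumulates at an end. -/
theorem exists_end_inter_nonempty {V : Type u} (Γ : SimpleGraph V) [Γ.LocallyFinite]
    [Fact Γ.Preconnected] {A : Set V} (hA : A.Infinite) :
    ∃ e ∈ Γ.end, ∀ K, ((e K).supp ∩ A).Nonempty := by
  have hne : (Filter.cofinite ⊓ Filter.principal A).NeBot :=
    Filter.cofinite_inf_principal_neBot_iff.2 hA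
  -- A non-principal ultrafilter containing `A` picks one of the finitely many components off each
  -- finite set; these choices are compatible because members of `U` intersect.
  let U : Ultrafilter V := Ultrafilter.of (Filter.cofinite ⊓ Filter.principal A)
  have hU : ↑U ≤ Filter.cofinite ⊓ Filter.principal A := Ultrafilter.of_le _
  have hUA : A ∈ U := hU (Filter.mem_inf_of_right (Filter.mem_principal_self A))
  have hex : ∀ K : (Finset V)ᵒᵖ, ∃ C : Γ.componentComplFunctor.obj K,
      ComponentCompl.supp C ∈ U := by
    intro K
    have hfin : Finite (Γ.ComponentCompl (K.unop : Set V)) := inferInstance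
    have h1 : ((K.unop : Set V)ᶜ) ∈ U :=
      hU (Filter.mem_inf_of_left (K.unop.finite_toSet.compl_mem_cofinite))
    have h2 : (⋃ C : Γ.ComponentCompl (K.unop : Set V), C.supp) ∈ U := by
      filter_upwards [h1] with v hv
      exact Set.mem_iUnion.2 ⟨Γ.componentComplMk hv, Γ.componentComplMk_mem hv⟩
    rw [← Set.biUnion_univ, Ultrafilter.finite_biUnion_mem_iff (Set.toFinite _)] at h2
    obtain ⟨C, -, hC⟩ := h2
    exact ⟨C, hC⟩
  choose e he using hex
  refine ⟨e, ?_, fun K => U.nonempty_of_mem (Filter.inter_mem (he K) hUA)⟩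
  intro K L h
  obtain ⟨v, hv, hv'⟩ := U.nonempty_of_mem (Filter.inter_mem (he K) (he L))
  refine (ComponentCompl.hom_eq_iff_not_disjoint (e K) (CategoryTheory.le_of_op_hom h) (e L)).2 ?_
  exact Set.not_disjoint_iff.2 ⟨v, hv, hv'⟩

variable {G : Type u} [Group G]

/-- A set is almost invariant if every right translate differs from it by a finite set. -/
def AlmostInvariant (A : Set G) : Prop :=
  ∀ g : G, {x | x ∈ A ∧ x * g ∉ A}.Finite

/-- The exceptional set of `g * g'` lies in that of `g` together with a translate of that of `g'`.
Inverses are carried along so that the closure induction goes through. -/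
theorem AlmostInvariant.of_closure_eq_top {A : Set G} {S : Set G}
    (hS : Subgroup.closure S = ⊤)
    (h : ∀ g ∈ S, {x | x ∈ A ∧ x * g ∉ A}.Finite ∧ {x | x ∈ A ∧ x * g⁻¹ ∉ A}.Finite) :
    AlmostInvariant A := by
  have hmul : ∀ g g' : G, {x | x ∈ A ∧ x * g ∉ A}.Finite → {x | x ∈ A ∧ x * g' ∉ A}.Finite →
      {x | x ∈ A ∧ x * (g * g') ∉ A}.Finite := by
    intro g g' h1 h2
    refine (h1.union (h2.preimage (f := fun x => x * g) (mul_left_injective g).injOn)).subset ?_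
    rintro x ⟨hx, hx'⟩
    by_cases h3 : x * g ∈ A
    · exact Or.inr ⟨h3, by rwa [mul_assoc]⟩
    · exact Or.inl ⟨hx, h3⟩
  intro g
  have hg : g ∈ Subgroup.closure S := hS ▸ Subgroup.mem_top g
  suffices H : {x | x ∈ A ∧ x * g ∉ A}.Finite ∧ {x | x ∈ A ∧ x * g⁻¹ ∉ A}.Finite from H.1
  induction hg using Subgroup.closure_induction with
  | mem g hg => exact h g hg
  | one => simp
  | mul a b _ _ ha hb =>
    refine ⟨hmul a b ha.1 hb.1, ?_⟩
    rw [mul_inv_rev]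
    exact hmul _ _ hb.2 ha.2
  | inv a _ ha => simpa using ha.symm

theorem AlmostInvariant.compl {A : Set G} (hA : AlmostInvariant A) : AlmostInvariant Aᶜ := by
  intro g
  refine ((hA g⁻¹).preimage (f := fun x => x * g) (mul_left_injective g).injOn).subset ?_
  rintro x ⟨hx, hx'⟩
  exact ⟨not_not.1 hx', by simpa using hx⟩

theorem mulCayley_preconnected {S : Set G} (hS : Subgroup.closure S = ⊤) :
    (mulCayley S).Preconnected := by
  have h : ∀ g : G, ∀ x, (mulCayley S).Reachable x (x * g) := by
    intro g
    have hg : g ∈ Subgroup.closure S := hS ▸ Subgroup.mem_top g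
    induction hg using Subgroup.closure_induction with
    | mem g hg =>
      intro x
      by_cases hx : x = x * g
      · rw [← hx]
      · exact Adj.reachable ((mulCayley_adj S _ _).2 ⟨hx, Or.inl (by simpa using hg)⟩)
    | one => intro x; rw [mul_one]
    | mul a b _ _ ha hb =>
      intro x
      rw [← mul_assoc]
      exact (ha x).trans (hb _)
    | inv a _ ha =>
      intro x
      simpa using (ha (x * a⁻¹)).symm
  intro x y
  simpa using h (x⁻¹ * y) x

theorem mulCayley_neighborSet_finite (S : Finset G) (x : G) :
    ((mulCayley (S : Set G)).neighborSet x).Finite := by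
  refine ((S.finite_toSet.image fun g => x * g).union
    (S.finite_toSet.image fun g => x * g⁻¹)).subset ?_
  intro y hy
  obtain ⟨-, h | h⟩ := (mulCayley_adj _ _ _).1 hy
  · exact Or.inl ⟨_, h, by simp⟩
  · exact Or.inr ⟨_, h, by simp⟩

/-- Stallings' description of the number of ends in terms of almost invariant sets. -/
theorem cayleyNumEnds_eq_one_iff {S : Finset G} (hS : Subgroup.closure (S : Set G) = ⊤) :
    cayleyNumEnds (S : Set G) = 1 ↔
      Infinite G ∧ ∀ A : Set G, AlmostInvariant A → A.Finite ∨ Aᶜ.Finite := by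
  classical
  let Γ := mulCayley (S : Set G)
  have hpre : Fact Γ.Preconnected := ⟨mulCayley_preconnected hS⟩
  let _ : Γ.LocallyFinite := fun x => (mulCayley_neighborSet_finite S x).fintype
  rw [cayleyNumEnds, Set.encard_eq_one]
  constructor
  · rintro ⟨e, he⟩
    have heq : ∀ e' ∈ Γ.end, e' = e := fun e' h => by
      have : e' ∈ (mulCayley (S : Set G)).end := h
      rwa [he] at this
    have heΓ : e ∈ Γ.end := by
      change e ∈ (mulCayley (S : Set G)).end
      rw [he]; rfl
    refine ⟨Set.infinite_univ_iff.1 ((infinite_supp_of_mem_end heΓ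
      (Opposite.op ∅)).mono (Set.subset_univ _)), fun A hA => ?_⟩
    by_contra! hcon
    obtain ⟨h1, h2⟩ := hcon
    have hBf : (⋃ g ∈ S, ({x | x ∈ A ∧ x * g ∉ A} ∪ {x | x ∈ Aᶜ ∧ x * g ∉ Aᶜ})).Finite :=
      S.finite_toSet.biUnion fun g _ => (hA g).union (hA.compl g)
    -- Off the finite boundary of `A`, every component lies in `A` or in its complement. Yet if both
    -- are infinite, both accumulate at the only end.
    let K : (Finset G)ᵒᵖ := Opposite.op hBf.toFinset
    have hKmem : ∀ x y, x ∉ hBf.toFinset → y ∉ hBf.toFinset → Γ.Adj x y → (x ∈ A ↔ y ∈ A) := by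
      have key : ∀ x, x ∉ hBf.toFinset → ∀ g ∈ S, (x ∈ A ↔ x * g ∈ A) := by
        intro x hx g hg
        by_contra h
        apply hx
        rw [Set.Finite.mem_toFinset, Set.mem_iUnion₂]
        refine ⟨g, hg, ?_⟩
        by_cases h3 : x ∈ A
        · exact Or.inl ⟨h3, fun h4 => h (iff_of_true h3 h4)⟩
        · exact Or.inr ⟨h3, fun h4 => h (iff_of_false h3 h4)⟩
      intro x y hx hy h
      obtain ⟨-, h | h⟩ := (mulCayley_adj _ _ _).1 h
      · simpa using key x hx _ h
      · simpa using (key y hy _ h).symm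
    have hconst : ∀ C : Γ.ComponentCompl (hBf.toFinset : Set G), ∀ x ∈ C.supp, ∀ y ∈ C.supp,
        x ∈ A → y ∈ A := by
      intro C x ⟨hx, hxC⟩ y ⟨hy, hyC⟩ h
      let F : Γ.ComponentCompl (hBf.toFinset : Set G) → Prop :=
        ComponentCompl.lift (fun v _ => v ∈ A) fun v w hv hw h => propext (hKmem v w hv hw h)
      have h3 : F (Γ.componentComplMk hx) := h
      rw [hxC, ← hyC] at h3
      exact h3
    obtain ⟨e₁, he₁, h₁⟩ := exists_end_inter_nonempty Γ h1
    obtain ⟨e₂, he₂, h₂⟩ := exists_end_inter_nonempty Γ h2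
    obtain rfl := heq _ he₁
    obtain rfl := heq _ he₂
    obtain ⟨x, hx, hxA⟩ := h₁ K
    obtain ⟨y, hy, hyA⟩ := h₂ K
    exact hyA (hconst _ x hx y hy hxA)
  · rintro ⟨hinf, hA⟩
    obtain ⟨e, he, -⟩ := exists_end_inter_nonempty Γ Set.infinite_univ
    refine ⟨e, Set.eq_singleton_iff_unique_mem.2 ⟨he, fun e' he' => ?_⟩⟩
    by_contra hne
    obtain ⟨K, hK⟩ := Function.ne_iff.1 hne
    let C : Γ.ComponentCompl (K.unop : Set G) := e K
    let C' : Γ.ComponentCompl (K.unop : Set G) := e' K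
    have hinfC : C.supp.Infinite := infinite_supp_of_mem_end he K
    have hinfC' : C'.supp.Infinite := infinite_supp_of_mem_end he' K
    have hdisj : Disjoint C'.supp C.supp := ComponentCompl.pairwise_disjoint hK
    have hstep : ∀ g : G, (g ∈ S ∨ g⁻¹ ∈ S) → {x | x ∈ C.supp ∧ x * g ∉ C.supp}.Finite := by
      intro g hg
      refine (K.unop.finite_toSet.preimage (f := fun x => x * g)
        (mul_left_injective g).injOn).subset ?_
      rintro x ⟨hx, hxg⟩
      by_contra hxK
      refine hxg (ComponentCompl.mem_of_adj x (x * g) hx hxK ?_)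
      refine (mulCayley_adj _ _ _).2 ⟨fun h => hxg (h ▸ hx), ?_⟩
      simpa using hg
    -- A finite set `K` separating two ends gives the almost invariant set `C.supp`: infinite, and
    -- with a complement containing the infinite `C'.supp`.
    have hai : AlmostInvariant C.supp := AlmostInvariant.of_closure_eq_top hS fun g hg =>
      ⟨hstep g (Or.inl hg), hstep g⁻¹ (Or.inr (by simpa using hg))⟩
    rcases hA _ hai with h | h
    · exact hinfC h
    · exact hinfC' (h.subset fun x hx hx' => Set.disjoint_left.1 hdisj hx hx')

/-- This form no longer mentions a generating set, so it can be compared between a group and a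
subgroup. -/
theorem isOneEnded_iff : IsOneEnded G ↔ Group.FG G ∧ Infinite G ∧
    ∀ A : Set G, AlmostInvariant A → A.Finite ∨ Aᶜ.Finite := by
  constructor
  · rintro ⟨S, hS, h⟩
    exact ⟨⟨S, hS⟩, (cayleyNumEnds_eq_one_iff hS).1 h⟩
  · rintro ⟨⟨S, hS⟩, h⟩
    exact ⟨S, hS, (cayleyNumEnds_eq_one_iff hS).2 h⟩

/-- A group with an embedding onto a finite-index subgroup of a one-ended group is one-ended. -/
theorem IsOneEnded.of_injective {N : Type v} [Group N] (hG : IsOneEnded G) (f : N →* G)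
    (hf : Function.Injective f) [hfi : f.range.FiniteIndex] : IsOneEnded N := by
  rw [isOneEnded_iff] at hG ⊢
  obtain ⟨hfg, hinf, hA⟩ := hG
  have hrange : Group.FG f.range := inferInstance
  let E : N ≃* f.range := MonoidHom.ofInjective hf
  refine ⟨Group.fg_of_surjective (f := (E.symm : f.range →* N)) E.symm.surjective, ?_,
    fun A hAi => ?_⟩
  · by_contra h
    rw [not_infinite_iff_finite] at h
    have h1 : Finite f.range := Finite.of_equiv _ E.toEquiv
    have h2 : Finite (G ⧸ f.range) := inferInstance
    exact hinf.not_finite (Finite.of_equiv _ (Subgroup.groupEquivQuotientProdSubgroup (s := f.range)).symm)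
  -- A transversal containing `1` gives a left `N`-equivariant retraction `p` of `G` onto `N`, along
  -- which almost invariant sets are pulled back.
  obtain ⟨t, ht, ht1⟩ := f.range.exists_isComplement_right 1
  have htf : t.Finite := ht.finite_right
  let p : G → N := fun x => E.symm (ht.equiv x).1
  have hfp : ∀ x, f (p x) * (ht.equiv x).2 = x := fun x => by
    have h1 : f (p x) = (ht.equiv x).1 :=
      congrArg Subtype.val (E.apply_symm_apply (ht.equiv x).1)
    rw [h1, ht.equiv_fst_mul_equiv_snd]
  have hp : ∀ n x, p (f n * x) = n * p x := fun n x => by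
    have h1 := ht.equiv_mul_left ⟨f n, n, rfl⟩ x
    have h2 : E.symm ⟨f n, n, rfl⟩ = n := E.symm_apply_apply n
    simp only [p]
    rw [h1, map_mul, h2]
  have hp1 : p 1 = 1 := by
    simp only [p]
    rw [ht.equiv_fst_eq_one_of_mem_of_one_mem f.range.one_mem ht1]
    exact map_one E.symm
  have hpf : ∀ n, p (f n) = n := fun n => by simpa [hp1] using hp n 1
  -- If `x = f (p x) * r` with `r ∈ t`, then `p (x * g) = p x * p (r * g)`. Only finitely many `r`
  -- occur, so almost invariance of `A` applies to finitely many translations.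
  have hB : AlmostInvariant (p ⁻¹' A) := by
    intro g
    refine (htf.biUnion fun r _ => ((hAi (p (r * g))).image fun n => f n * r)).subset ?_
    rintro x ⟨hx, hxg⟩
    refine Set.mem_biUnion (ht.equiv x).2.2 ⟨p x, ⟨hx, fun h => hxg ?_⟩, hfp x⟩
    rw [← hp, ← mul_assoc, hfp] at h
    exact h
  have hpre : ∀ B : Set N, (p ⁻¹' B).Finite → B.Finite := fun B h =>
    (h.preimage hf.injOn).subset fun n hn => by simpa [hpf] using hn
  exact (hA _ hB).imp (hpre A) (hpre Aᶜ)

end Ends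

/-! ### Powers of automorphisms and suspensions. -/

section Suspensions

variable {G : Type u} [Group G]

theorem finite_monoidHom_of_fg [hfg : Group.FG G] (Q : Type*) [Group Q] [Finite Q] :
    Finite (G →* Q) := by
  obtain ⟨S, hS⟩ := hfg
  refine Finite.of_injective (fun φ : G →* Q => fun s : (S : Set G) => φ s) fun φ φ' h => ?_
  exact MonoidHom.eq_of_eqOn_dense hS fun s hs => congrFun h ⟨s, hs⟩

/-- By pigeonhole among the finitely many homomorphisms `G →* Q`, `φ ∘ Φ ^ m = φ ∘ Φ ^ n` with `m <
n`; cancelling `Φ ^ m` leaves `k = n - m`. -/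
theorem exists_pow_comp_eq [Group.FG G] {Q : Type*} [Group Q] [Finite Q] (φ : G →* Q)
    (Φ : MulAut G) : ∃ k, 0 < k ∧ ∀ x, φ ((Φ ^ k) x) = φ x := by
  have := finite_monoidHom_of_fg (G := G) Q
  obtain ⟨m, n, hmn, h⟩ := Finite.exists_ne_map_eq_of_infinite
    fun n : ℕ => φ.comp (Φ ^ n).toMonoidHom
  wlog hlt : m < n generalizing m n
  · exact this n m hmn.symm h.symm (lt_of_le_of_ne (not_lt.1 hlt) hmn.symm)
  refine ⟨n - m, Nat.sub_pos_of_lt hlt, fun x => ?_⟩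
  have h1 := DFunLike.congr_fun h ((Φ ^ m)⁻¹ x)
  change φ ((Φ ^ m) ((Φ ^ m)⁻¹ x)) = φ ((Φ ^ n) ((Φ ^ m)⁻¹ x)) at h1
  rw [MulAut.apply_inv_self] at h1
  rw [h1, pow_sub _ hlt.le]
  rfl

/-- An automorphism of `G` preserving `K` restricts to `K`. -/
def restrictMulAut (K : Subgroup G) (Θ : MulAut G) (h : ∀ x, Θ x ∈ K ↔ x ∈ K) : MulAut K where
  toFun x := ⟨Θ x, (h x).2 x.2⟩
  invFun x := ⟨Θ⁻¹ x, (h _).1 (by rw [MulAut.apply_inv_self]; exact x.2)⟩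
  left_inv x := Subtype.ext (MulAut.inv_apply_self G Θ x)
  right_inv x := Subtype.ext (MulAut.apply_inv_self G Θ x)
  map_mul' x y := Subtype.ext (map_mul Θ (x : G) y)

theorem coe_restrictMulAut_zpow (K : Subgroup G) (Θ : MulAut G) (h : ∀ x, Θ x ∈ K ↔ x ∈ K)
    (n : ℤ) : ∀ x : K, (((restrictMulAut K Θ h) ^ n) x : G) = (Θ ^ n) (x : G) := by
  induction n using Int.induction_on with
  | zero => intro x; rfl
  | succ n ih =>
    intro x
    rw [zpow_add_one, zpow_add_one, MulAut.mul_apply, MulAut.mul_apply, ih]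
    rfl
  | pred n ih =>
    intro x
    rw [zpow_sub_one, zpow_sub_one, MulAut.mul_apply, MulAut.mul_apply, ih]
    rfl

theorem exists_suspension_embedding (K : Subgroup G) [K.FiniteIndex] (Φ : MulAut G) {k : ℕ}
    (hk : 0 < k) (hK : ∀ x, (Φ ^ k) x ∈ K ↔ x ∈ K) :
    ∃ Ψ : MulAut K, (∀ x : K, ((Ψ x : K) : G) = (Φ ^ k) (x : G)) ∧
      ∃ j : Suspension Ψ →* Suspension Φ, Function.Injective j ∧
        (∀ x : K, j (SemidirectProduct.inl x) = SemidirectProduct.inl (x : G)) ∧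
        j (Suspension.t Ψ) = Suspension.t Φ ^ k ∧ j.range.FiniteIndex := by
  let Ψ := restrictMulAut K (Φ ^ k) hK
  let j : Suspension Ψ →* Suspension Φ := SemidirectProduct.map K.subtype (powMonoidHom k) (by
    intro n
    ext x
    change (((zpowersHom (MulAut K) Ψ n) x : K) : G) = (zpowersHom (MulAut G) Φ (n ^ k)) x
    rw [map_pow, zpowersHom_apply, zpowersHom_apply, coe_restrictMulAut_zpow, ← zpow_natCast,
      ← zpow_natCast, ← zpow_mul, ← zpow_mul, mul_comm])
  have hjinl : ∀ x : K, j (SemidirectProduct.inl x) = SemidirectProduct.inl (x : G) := fun x =>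
    SemidirectProduct.map_inl _ _ _ x
  have hjt : j (Suspension.t Ψ) = Suspension.t Φ ^ k := by
    change j (SemidirectProduct.inr _) = (SemidirectProduct.inr _) ^ k
    rw [← map_pow]
    exact SemidirectProduct.map_inr _ _ _ _
  refine ⟨Ψ, fun x => rfl, j, ?_, hjinl, hjt, ?_⟩
  · intro a b h
    have h1 : (a.left : G) = b.left := congrArg SemidirectProduct.left h
    have h2 : a.right ^ k = b.right ^ k := congrArg SemidirectProduct.right h
    refine SemidirectProduct.ext (Subtype.ext h1) ?_
    have h3 : (k : ℤ) * a.right.toAdd = k * b.right.toAdd := by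
      simpa using congrArg Multiplicative.toAdd h2
    exact Multiplicative.toAdd.injective (mul_left_cancel₀ (by exact_mod_cast hk.ne') h3)
  · let t := Suspension.t Φ
    -- The cosets of the image are represented by `t ^ i * g` with `i < k` and `g` modulo `K`.
    -- Surjectivity comes from dividing the exponent of `t` by `k` and moving `t ^ i` to the left.
    let F : Fin k × (G ⧸ K) → Suspension Φ ⧸ j.range := fun p =>
      Quotient.map' (s₁ := QuotientGroup.leftRel K) (s₂ := QuotientGroup.leftRel j.range)
        (fun g : G => t ^ (p.1 : ℕ) * SemidirectProduct.inl g) (by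
          intro a b h
          rw [QuotientGroup.leftRel_apply] at h ⊢
          refine ⟨SemidirectProduct.inl ⟨_, h⟩, ?_⟩
          rw [hjinl]
          simp only [map_mul, map_inv]
          group) p.2
    have hsurj : Function.Surjective F := by
      intro y
      induction y using QuotientGroup.induction_on with
      | H y =>
        have hy : y = SemidirectProduct.inl y.left * t ^ (y.right.toAdd) := by
          conv_lhs => rw [← SemidirectProduct.inl_left_mul_inr_right y]
          congr 1
          change SemidirectProduct.inr y.right = (SemidirectProduct.inr _) ^ _
          rw [← map_zpow]
          congr 1
          simp [← ofAdd_zsmul]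
        let n := y.right.toAdd
        have hn0 : 0 ≤ n % k := Int.emod_nonneg _ (by exact_mod_cast hk.ne')
        have hnk : n % k < k := Int.emod_lt_of_pos _ (by exact_mod_cast hk)
        let i : ℕ := (n % k).toNat
        have hi : (i : ℤ) = n % k := Int.toNat_of_nonneg hn0
        have hconj : ∀ (g : G), SemidirectProduct.inl g * t ^ i =
            t ^ i * SemidirectProduct.inl ((Φ ^ i)⁻¹ g) := by
          intro g
          have h1 := SemidirectProduct.inl_aut (φ := zpowersHom (MulAut G) Φ)
            (Multiplicative.ofAdd 1 ^ i) ((Φ ^ i)⁻¹ g)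
          have h2 : (zpowersHom (MulAut G) Φ) (Multiplicative.ofAdd 1 ^ i) = Φ ^ i := by
            rw [map_pow]; simp
          rw [h2, MulAut.apply_inv_self, map_inv, map_pow] at h1
          change (SemidirectProduct.inl g : Suspension Φ) = t ^ i * _ * (t ^ i)⁻¹ at h1
          rw [h1, inv_mul_cancel_right]
        refine ⟨(⟨i, by omega⟩, QuotientGroup.mk ((Φ ^ i)⁻¹ y.left)), ?_⟩
        change (QuotientGroup.mk (t ^ i * SemidirectProduct.inl _) : Suspension Φ ⧸ j.range) = _
        rw [QuotientGroup.eq]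
        refine ⟨Suspension.t Ψ ^ (n / k), ?_⟩
        rw [map_zpow, hjt, ← hconj, eq_inv_mul_iff_mul_eq]
        conv_rhs => rw [hy]
        rw [mul_assoc, ← zpow_natCast t i, ← zpow_natCast (Suspension.t Φ) k, ← zpow_mul,
          ← zpow_add, hi, Int.emod_add_mul_ediv]
    have : Finite (Suspension Φ ⧸ j.range) := Finite.of_surjective F hsurj
    exact Subgroup.finiteIndex_of_finite_quotient

theorem Subgroup.FiniteIndex.exists_finite_orbit_representatives {Y : Type*} [MulAction G Y]
    (K : Subgroup G) [K.FiniteIndex] {F : Set Y} (hF : F.Finite) :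
    ∃ F' : Set Y, F'.Finite ∧ ∀ y, (∃ g : G, g • y ∈ F) → ∃ g : K, g • y ∈ F' := by
  refine ⟨Set.image2 (fun (q : G ⧸ K) y => q.out⁻¹ • y) Set.univ F,
    Set.Finite.image2 _ Set.finite_univ hF, ?_⟩
  rintro y ⟨g, hg⟩
  have h : (QuotientGroup.mk g : G ⧸ K).out⁻¹ * g ∈ K := by
    rw [← QuotientGroup.eq, QuotientGroup.out_eq']
  exact ⟨⟨_, h⟩, _, Set.mem_univ _, _, hg, (mul_smul _ _ _).symm⟩

end Suspensions

/-! ### Assembly of the main theorem. -/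

theorem mainTheorem11 (G : Type u) [Group G] (hfg : Group.FG G) (hinf : IsInfinitelyEnded G)
    (hacc : IsAccessible G)
    (V : Type v) [MulAction G V] (T : SimpleGraph V) (hT : IsStallingsDunwoody G T)
    (hsep : ∀ v : V, IsOneEnded (MulAction.stabilizer G v) →
      ∃ N : Subgroup (MulAction.stabilizer G v), N.Normal ∧ N.FiniteIndex ∧
        ∀ w : V, T.Adj v w →
          N ⊓ (MulAction.stabilizer G w).subgroupOf (MulAction.stabilizer G v) = ⊥) :
    ∃ K : Subgroup G, K.FiniteIndex ∧ IsFreeProductOneEndedFree K ∧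
      ∀ Φ : MulAut G, ∃ (k : ℕ) (Ψ : MulAut K), 0 < k ∧
        (∀ x : K, ((Ψ x : K) : G) = (Φ ^ k) (x : G)) ∧
        ∃ j : Suspension Ψ →* Suspension Φ, Function.Injective j ∧
          (∀ x : K, j (SemidirectProduct.inl x) = SemidirectProduct.inl (x : G)) ∧
          j (Suspension.t Ψ) = Suspension.t Φ ^ k ∧
          j.range.FiniteIndex := by
  -- At a finite vertex group the choice `N = ⊥` has finite index and makes `K` meet that group
  -- trivially.
  have hN : ∀ v : V, ∃ N : Subgroup (MulAction.stabilizer G v), N.Normal ∧ N.FiniteIndex ∧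
      (∀ w : V, T.Adj v w → ∀ g ∈ N, (g : G) • w = w → g = 1) ∧
      (Finite (MulAction.stabilizer G v) → N = ⊥) := by
    intro v
    by_cases hfin : Finite (MulAction.stabilizer G v)
    · exact ⟨⊥, inferInstance, inferInstance, fun w _ g hg _ => hg, fun _ => rfl⟩
    · obtain ⟨N, h1, h2, h3⟩ := hsep v ((hT.vertex_group v).resolve_left hfin)
      refine ⟨N, h1, h2, fun w hw g hg hgw => ?_, fun h => (hfin h).elim⟩
      have h4 : g ∈ N ⊓ (MulAction.stabilizer G w).subgroupOf (MulAction.stabilizer G v) :=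
        ⟨hg, hgw⟩
      rwa [h3 w hw] at h4
  choose N hNn hNf hN hNbot using hN
  obtain ⟨Q, _, _, φ, s, c, hc, hφ⟩ := exists_hom_finite_of_edge_trivial hT.isTree hT.smul_adj
    hT.no_inversion hT.finite_vertex_orbits hT.finite_edge_orbits hT.finite_edge_group N hNn hNf
    fun v w h g hg => hN v w h g hg
  have hconj : ∀ (v : V) (g : G), (c v)⁻¹ * g * c v = 1 → g = 1 := by
    intro v g h
    have h1 : g = c v * ((c v)⁻¹ * g * c v) * (c v)⁻¹ := by group
    rw [h1, h, mul_one, mul_inv_cancel]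
  have hKfin : φ.ker.FiniteIndex := inferInstance
  refine ⟨φ.ker, hKfin, ?_, fun Φ => ?_⟩
  · refine isFreeProductOneEndedFree_of_trivial_edge_groups (V := V) hT.isTree
      (fun g => hT.smul_adj g) (fun g => hT.no_inversion g) ?_ ?_ ?_ ?_
    · obtain ⟨F, hF, h⟩ := hT.finite_vertex_orbits
      obtain ⟨F', hF', h'⟩ :=
        Subgroup.FiniteIndex.exists_finite_orbit_representatives φ.ker hF
      exact ⟨F', hF', fun v => h' v (h v)⟩
    · obtain ⟨F, hF, h⟩ := hT.finite_edge_orbits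
      obtain ⟨F', hF', h'⟩ :=
        Subgroup.FiniteIndex.exists_finite_orbit_representatives φ.ker hF
      exact ⟨F', hF', fun v w hvw => h' (v, w) (h v w hvw)⟩
    · intro v w hvw g hv hw
      have hv' : (g : G) • v = v := hv
      have hw' : (g : G) • w = w := hw
      obtain ⟨h, hh, hhg⟩ := hφ v g hv' g.2
      -- Translating the edge by `(c v)⁻¹` moves it to the representative `s v`, where `N (s v)` is
      -- known to miss its group.
      have h1 : T.Adj (s v) ((c v)⁻¹ • w) := by
        have := hT.smul_adj (c v)⁻¹ v w hvw
        rwa [inv_smul_eq_iff.2 (hc v).symm] at this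
      have h2 := hN _ _ h1 h hh (by rw [hhg, mul_smul, mul_smul, smul_inv_smul, hw'])
      rw [h2, Subgroup.coe_one] at hhg
      exact Subtype.ext (hconj v g hhg.symm)
    · intro v
      by_cases hfin : Finite (MulAction.stabilizer G v)
      · left
        rw [eq_bot_iff]
        intro g hg
        obtain ⟨h, hh, hhg⟩ := hφ v g hg g.2
        have hfin' : Finite (MulAction.stabilizer G (s v)) := by
          rw [← hc v] at hfin
          exact Finite.of_equiv _
            (MulAction.stabilizerEquivStabilizer (g := c v) (a := s v) rfl).symm.toEquiv
        rw [hNbot _ hfin', Subgroup.mem_bot] at hh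
        rw [hh, Subgroup.coe_one] at hhg
        exact Subtype.ext (hconj v g hhg.symm)
      · right
        let f : MulAction.stabilizer φ.ker v →* MulAction.stabilizer G v :=
          (φ.ker.subtype.comp (Subgroup.subtype _)).codRestrict _ fun g => g.2
        have hf : Function.Injective f := fun a b h => by
          have : ((a : φ.ker) : G) = ((b : φ.ker) : G) :=
            (Subtype.ext_iff.1 h :)
          exact Subtype.ext (Subtype.ext this)
        have hr : f.range = φ.ker.subgroupOf (MulAction.stabilizer G v) := by
          ext g
          constructor
          · rintro ⟨a, rfl⟩
            exact a.1.2
          · intro hg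
            exact ⟨⟨⟨g, hg⟩, g.2⟩, rfl⟩
        have hfi : f.range.FiniteIndex := by
          rw [hr]
          infer_instance
        exact ((hT.vertex_group v).resolve_left hfin).of_injective f hf
  · obtain ⟨k, hk, h⟩ := exists_pow_comp_eq φ Φ
    obtain ⟨Ψ, h1, h2⟩ := exists_suspension_embedding φ.ker Φ hk fun x => by
      rw [MonoidHom.mem_ker, MonoidHom.mem_ker, h]
    exact ⟨k, Ψ, hk, h1, h2⟩
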